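/- Notation. Let $f,g_1,\dots,g_m\in\mathbb{R}[x_1,\dots,x_n]$, $d_0=\deg f$, $K=\{x\in\mathbb{R}^n: g_j(x)\ge 0,\ j=1,\dots,m\}$, $\mathbb{N}^n_d=\{\alpha\in\mathbb{N}^n:|\alpha|\le d\}$, $v_j=\lceil(\deg g_j)/2\rceil$, and let $\mathbf P$ be the problem $\min\{f(x):x\in K\}$. For $k\in\{1,\infty\}$ let $\|h\|_k$ be the $\ell_k$-norm of the coefficient vector $(h_\alpha)_{\alpha\in\mathbb{N}^n_{d_0}}$ of a polynomial $h$ of degree at most $d_0$. Let $$Q(g)=\Big\{\sigma_0+\sum_{j=1}^m\sigma_jg_j:\ \sigma_0,\dots,\sigma_m \text{ sums of squares}\Big\},$$ and let $Q_d(g)$ be its subset where $\deg\sigma_0\le 2d$ and $\deg\sigma_j\le 2(d-v_j)$. $Q(g)$ is Archimedean if $M-\|x\|^2\in Q(g)$ for some $M>0$. Put $$\rho^k=\inf\{\|\tilde f-f\|_k:\ \deg\tilde f\le d_0,\ \tilde f-\tilde f(0)\ge 0\text{ on }K\},\qquad \rho^k_d=\inf\{\|\tilde f-f\|_k:\ \deg\tilde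 f\le d_0,\ \tilde f-\tilde f(0)\in Q_d(g)\};$$ the first is called the ideal problem. For $z=(z_\alpha)$ let $L_z(h)=\sum_\alpha h_\alpha z_\alpha$, and let $M_d(z)=(z_{\alpha+\beta})_{\alpha,\beta\in\mathbb{N}^n_d}$ and $M_d(g_jz)=(L_z(x^{\alpha+\beta}g_j))_{\alpha,\beta\in\mathbb{N}^n_d}$ be the moment and localizing matrices. The dual problem of order $d$ (for $d\ge1$, $2d\ge d_0$, $d\ge\max_jv_j$) is to maximize $L_z(f(0)-f)$ over those $z$ with $M_d(z)\succeq0$ and $M_{d-v_j}(g_jz)\succeq0$ for $j=1,\dots,m$ for which there are $u,v\ge0$ with $u_\alpha-v_\alpha+z_\alpha=0$ for all $\alpha\in\mathbb{N}^n_{d_0}\setminus\{0\}$ and $$u_\alpha+v_\alpha\le1\ \ \forall\alpha\in\mathbb{N}^n_{d_0}\setminus\{0\}\quad(k=1),\qquad\text{resp. }\sum_{\alpha\in\mathbb{N}^n_{d_0}\setminus\{0\}}(u_\alpha+v_\alpha)\le1\quad(k=\infty).$$ The measure dual of the ideal problem is to maximize $\int_K(f(0)-f)\,d\mu$ over the finite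 Borel measures $\mu$ on $K$ with $$\Big|\int_Kx^\alpha d\mu\Big|\le1\ \ \forall\alpha\in\mathbb{N}^n_{d_0}\setminus\{0\}\quad(k=1),\qquad\text{resp. }\sum_{\alpha\in\mathbb{N}^n_{d_0}\setminus\{0\}}\Big|\int_Kx^\alpha d\mu\Big|\le1\quad(k=\infty).$$ Lemma. Let $k\in\{1,\infty\}$. Assume that $0\in K$, that $K$ has nonempty interior and that $Q(g)$ is Archimedean. For every $d\ge 1$ with $2d\ge d_0$ and $d\ge\max_jv_j$, let $z^d$ be a feasible solution of the dual problem of order $d$ with value $L_{z^d}(f(0)-f)\ge\rho^k_d-1/d$. If $\liminf_{d\to\infty}z^d_0<\infty$, then: 1. $\lim_{d\to\infty}\rho^k_d=\rho^k$. 2. The ideal problem has an optimal solution, and the measure dual has an optimal solution $\mu^*$ which, for every optimal solution $\tilde f^*$ of the ideal problem, is supported on the set of global minimizers of $\tilde f^*$ on $K$ (a set which contains $0$). 3. For every optimal solution $\tilde f^*$ of the ideal problem: either $\rho^k=0$, in which case $0$ is an optimal solution of $\mathbf P$, or $\rho^k>0$ and $\tilde f^*$ has another global minimizer $\tilde x\ne0$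 on $K$ with $f(\tilde x)<f(0)$. -/

import Mathlib

open MvPolynomial MeasureTheory Filter Topology

noncomputable section

namespace InversePoly

/-- The set of multi-indices `α ∈ ℕ^n` with `|α| ≤ d`. -/
def multiIdx (n d : ℕ) : Finset (Fin n →₀ ℕ) :=
  (Finsupp.finite_of_degree_le (σ := Fin n) d).toFinset

theorem mem_multiIdx {n d : ℕ} {α : Fin n →₀ ℕ} : α ∈ multiIdx n d ↔ α.degree ≤ d := by
  simp [multiIdx]

theorem multiIdx_nonempty (n d : ℕ) : (multiIdx n d).Nonempty :=
  ⟨0, by simp [mem_multiIdx]⟩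

/-- The two coefficient norms under consideration: `ℓ_1` and `ℓ_∞`. -/
inductive NormIdx : Type
  | one
  | infty

/-- The `ℓ_1`- resp. `ℓ_∞`-norm of the vector of coefficients `(h_α)`, `|α| ≤ d`. -/
def coeffNorm {n : ℕ} (d : ℕ) : NormIdx → MvPolynomial (Fin n) ℝ → ℝ
  | .one, h => ∑ α ∈ multiIdx n d, |h.coeff α|
  | .infty, h => (multiIdx n d).sup' (multiIdx_nonempty n d) fun α => |h.coeff α|

/-- The basic closed semialgebraic set `K = {x : g_j(x) ≥ 0, j = 1, …, m}`. -/
def feasSet {n m : ℕ} (g : Fin m → MvPolynomial (Fin n) ℝ) : Set (Fin n → ℝ) :=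
  {x | ∀ j, 0 ≤ eval x (g j)}

/-- The global minimizers of `p` on `K`. -/
def globalMinimizers {n : ℕ} (K : Set (Fin n → ℝ)) (p : MvPolynomial (Fin n) ℝ) :
    Set (Fin n → ℝ) :=
  {x | x ∈ K ∧ ∀ y ∈ K, eval x p ≤ eval y p}

/-- Sums of squares of degree at most `2 d`. -/
def sosDeg (n d : ℕ) : Set (MvPolynomial (Fin n) ℝ) :=
  {s | IsSumSq s ∧ s.totalDegree ≤ 2 * d}

/-- `⌈deg p / 2⌉`. -/
def halfDeg {n : ℕ} (p : MvPolynomial (Fin n) ℝ) : ℕ := (p.totalDegree + 1) / 2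

/-- The quadratic module `Q(g)`: the polynomials `σ₀ + ∑ σ_j g_j` with all `σ_j` s.o.s. -/
def quadModule {n m : ℕ} (g : Fin m → MvPolynomial (Fin n) ℝ) :
    Set (MvPolynomial (Fin n) ℝ) :=
  {h | ∃ (σ₀ : MvPolynomial (Fin n) ℝ) (σ : Fin m → MvPolynomial (Fin n) ℝ),
    IsSumSq σ₀ ∧ (∀ j, IsSumSq (σ j)) ∧ h = σ₀ + ∑ j, σ j * g j}

/-- The truncated quadratic module `Q_d(g)`: the polynomials `σ₀ + ∑ σ_j g_j` with s.o.s. `σ₀` of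
degree at most `2 d` and s.o.s. `σ_j` of degree at most `2 (d - v_j)`, `v_j = ⌈deg g_j / 2⌉`.
This is meant for `d ≥ v_j` for all `j`. -/
def truncQuadModule {n m : ℕ} (g : Fin m → MvPolynomial (Fin n) ℝ) (d : ℕ) :
    Set (MvPolynomial (Fin n) ℝ) :=
  {h | ∃ (σ₀ : MvPolynomial (Fin n) ℝ) (σ : Fin m → MvPolynomial (Fin n) ℝ),
    σ₀ ∈ sosDeg n d ∧ (∀ j, σ j ∈ sosDeg n (d - halfDeg (g j))) ∧ h = σ₀ + ∑ j, σ j * g j}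

/-- `Q(g)` is Archimedean: it contains `M - ‖x‖²` for some `M > 0`. -/
def IsArchimedean {n m : ℕ} (g : Fin m → MvPolynomial (Fin n) ℝ) : Prop :=
  ∃ M : ℝ, 0 < M ∧ C M - ∑ i, X i ^ 2 ∈ quadModule g

/-- Feasible points of the ideal inverse problem (at the point `0`): the polynomials `h` of degree
at most `deg f` such that `h - h(0)` is nonnegative on `K`. -/
def idealFeasible {n m : ℕ} (f : MvPolynomial (Fin n) ℝ) (g : Fin m → MvPolynomial (Fin n) ℝ) :
    Set (MvPolynomial (Fin n) ℝ) :=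
  {h | h.totalDegree ≤ f.totalDegree ∧ ∀ x ∈ feasSet g, 0 ≤ eval x (h - C (eval 0 h))}

/-- The optimal value `ρ^k` of the ideal inverse problem. -/
def idealValue {n m : ℕ} (k : NormIdx) (f : MvPolynomial (Fin n) ℝ)
    (g : Fin m → MvPolynomial (Fin n) ℝ) : ℝ :=
  sInf ((fun h => coeffNorm f.totalDegree k (h - f)) '' idealFeasible f g)

/-- `h` is an optimal solution of the ideal inverse problem. -/
def IsIdealOptimal {n m : ℕ} (k : NormIdx) (f : MvPolynomial (Fin n) ℝ)
    (g : Fin m → MvPolynomial (Fin n) ℝ) (h : MvPolynomial (Fin n) ℝ) : Prop :=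
  h ∈ idealFeasible f g ∧
    ∀ h' ∈ idealFeasible f g,
      coeffNorm f.totalDegree k (h - f) ≤ coeffNorm f.totalDegree k (h' - f)

/-- Feasible points of the practical inverse problem with degree bound `d`: the polynomials `h` of
degree at most `deg f` such that `h - h(0) ∈ Q_d(g)`. -/
def practicalFeasible {n m : ℕ} (f : MvPolynomial (Fin n) ℝ)
    (g : Fin m → MvPolynomial (Fin n) ℝ) (d : ℕ) : Set (MvPolynomial (Fin n) ℝ) :=
  {h | h.totalDegree ≤ f.totalDegree ∧ h - C (eval 0 h) ∈ truncQuadModule g d}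

/-- The optimal value `ρ_d^k` of the practical inverse problem with degree bound `d`. -/
def practicalValue {n m : ℕ} (k : NormIdx) (f : MvPolynomial (Fin n) ℝ)
    (g : Fin m → MvPolynomial (Fin n) ℝ) (d : ℕ) : ℝ :=
  sInf ((fun h => coeffNorm f.totalDegree k (h - f)) '' practicalFeasible f g d)

/-- The linear functional `L_z(p) = ∑_α p_α z_α`. -/
def rieszFun {n : ℕ} (z : (Fin n →₀ ℕ) → ℝ) (p : MvPolynomial (Fin n) ℝ) : ℝ :=
  ∑ α ∈ p.support, p.coeff α * z α

/-- The moment matrix `M_d(z)`, indexed by `|α|, |β| ≤ d`, with entries `z_{α+β}`. -/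
def momentMatrix {n : ℕ} (d : ℕ) (z : (Fin n →₀ ℕ) → ℝ) :
    Matrix (multiIdx n d) (multiIdx n d) ℝ :=
  Matrix.of fun α β => z (α.1 + β.1)

/-- The localizing matrix `M_d(p z)`, indexed by `|α|, |β| ≤ d`, with entries
`∑_γ p_γ z_{α+β+γ}`. -/
def localizingMatrix {n : ℕ} (d : ℕ) (p : MvPolynomial (Fin n) ℝ) (z : (Fin n →₀ ℕ) → ℝ) :
    Matrix (multiIdx n d) (multiIdx n d) ℝ :=
  Matrix.of fun α β => ∑ γ ∈ p.support, p.coeff γ * z (α.1 + β.1 + γ)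

/-- The normalization constraint on the dual variables `u, v` belonging to each norm, the index `α`
ranging over `0 < |α| ≤ d₀`. -/
def dualNormConstraint {n : ℕ} (d₀ : ℕ) : NormIdx → (u v : (Fin n →₀ ℕ) → ℝ) → Prop
  | .one, u, v => ∀ α ∈ (multiIdx n d₀).erase 0, u α + v α ≤ 1
  | .infty, u, v => ∑ α ∈ (multiIdx n d₀).erase 0, (u α + v α) ≤ 1

/-- `z` is (the `z`-part of) a feasible solution of the semidefinite program dual to the practical
inverse problem with degree bound `d`. Only the entries `z_α` with `|α| ≤ 2 d` occur as soon as
`2 d ≥ deg f` and `d ≥ ⌈deg g_j / 2⌉` for all `j`, which is when the program makes sense. -/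
def IsDualFeasible {n m : ℕ} (k : NormIdx) (f : MvPolynomial (Fin n) ℝ)
    (g : Fin m → MvPolynomial (Fin n) ℝ) (d : ℕ) (z : (Fin n →₀ ℕ) → ℝ) : Prop :=
  (∃ u v : (Fin n →₀ ℕ) → ℝ, (∀ α, 0 ≤ u α) ∧ (∀ α, 0 ≤ v α) ∧
    dualNormConstraint f.totalDegree k u v ∧
    ∀ α ∈ (multiIdx n f.totalDegree).erase 0, u α - v α + z α = 0) ∧
  (momentMatrix d z).PosSemidef ∧
  ∀ j, (localizingMatrix (d - halfDeg (g j)) (g j) z).PosSemidef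

/-- The moment constraint, belonging to each norm, of the measure dual of the ideal problem. -/
def momentConstraint {n : ℕ} (d₀ : ℕ) (K : Set (Fin n → ℝ)) :
    NormIdx → Measure (Fin n → ℝ) → Prop
  | .one, μ => ∀ α ∈ (multiIdx n d₀).erase 0, |∫ x in K, eval x (monomial α 1) ∂μ| ≤ 1
  | .infty, μ => ∑ α ∈ (multiIdx n d₀).erase 0, |∫ x in K, eval x (monomial α 1) ∂μ| ≤ 1

/-- Feasible points of the measure dual: finite Borel measures on `K` (i.e. giving no mass to the
complement of `K`) that satisfy the moment constraint. -/
def IsMeasureFeasible {n m : ℕ} (k : NormIdx) (f : MvPolynomial (Fin n) ℝ)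
    (g : Fin m → MvPolynomial (Fin n) ℝ) (μ : Measure (Fin n → ℝ)) : Prop :=
  IsFiniteMeasure μ ∧ μ (feasSet g)ᶜ = 0 ∧ momentConstraint f.totalDegree (feasSet g) k μ

/-- Optimal solutions of the measure dual: maximizers of `∫_K (f(0) - f) dμ`. -/
def IsMeasureOptimal {n m : ℕ} (k : NormIdx) (f : MvPolynomial (Fin n) ℝ)
    (g : Fin m → MvPolynomial (Fin n) ℝ) (μ : Measure (Fin n → ℝ)) : Prop :=
  IsMeasureFeasible k f g μ ∧
    ∀ ν : Measure (Fin n → ℝ), IsMeasureFeasible k f g ν →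
      ∫ x in feasSet g, (eval 0 f - eval x f) ∂ν ≤ ∫ x in feasSet g, (eval 0 f - eval x f) ∂μ

end InversePoly

end

open InversePoly

/-! Weak duality carries the argument. For a feasible measure `μ` and a feasible polynomial `h`,
Hölder's inequality on coefficients gives `∫ (f(0) - f) dμ + ∫ (h - h(0)) dμ ≤ ‖h - f‖`, and the
second integral is nonnegative (`setIntegral_add_le_coeffNorm`). The values `ρ_d` decrease to a
limit that is at least `ρ`, so it is enough to find a feasible measure of value at least `lim ρ_d`:
then `lim ρ_d ≤ ∫ (f(0) - f) dμ ≤ ρ ≤ lim ρ_d`.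

This measure is a limit of the `z^d` (`exists_isMeasureFeasible_ge`). Along an ultrafilter on which
`z^d_0` is bounded, the Archimedean condition bounds every `L_{z^d}(q)`, so a limit functional
exists, and it is nonnegative on `Q(g)`. By a Putinar-type argument through extreme states
(`apply_nonneg_of_nonneg_on_feasSet`) it is nonnegative on every polynomial that is nonnegative on
`K`, hence it is integration against a measure (`exists_measure_of_nonneg`).

Equality in weak duality annihilates `∫ (h - h(0)) dμ` for every optimal `h`, which locates the
support of `μ`. If `ρ > 0`, then `∫ (f(0) - f) dμ > 0`, so `f < f(0)` at some minimizer of `h`.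
Existence of an optimal `h` is compactness in coefficient space. -/

namespace InversePoly

/-! ### Positive functionals on real algebras: multipliers, states and characters. -/

section PositiveFunctional

variable {A : Type*} [CommRing A] [Algebra ℝ A]

/-- The elements `t` for which the functional `q ↦ L (t * q ^ 2)` is nonnegative. -/
def posMultipliers (L : A →ₗ[ℝ] ℝ) : Set A := {t | ∀ q, 0 ≤ L (t * q ^ 2)}

variable {L : A →ₗ[ℝ] ℝ}

theorem posMultipliers_add {a b : A} (ha : a ∈ posMultipliers L) (hb : b ∈ posMultipliers L) :
    a + b ∈ posMultipliers L := fun q => by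
  rw [add_mul, map_add]
  exact add_nonneg (ha q) (hb q)

theorem posMultipliers_smul {a : A} (ha : a ∈ posMultipliers L) {c : ℝ} (hc : 0 ≤ c) :
    c • a ∈ posMultipliers L := fun q => by
  rw [smul_mul_assoc, map_smul]
  exact mul_nonneg hc (ha q)

theorem posMultipliers_mul_sq {a : A} (ha : a ∈ posMultipliers L) (r : A) :
    a * r ^ 2 ∈ posMultipliers L := fun q => by
  rw [mul_assoc, ← mul_pow]
  exact ha _

theorem posMultipliers_sq (hL : ∀ q, 0 ≤ L (q ^ 2)) (r : A) : r ^ 2 ∈ posMultipliers L :=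
  fun q => by
    rw [← mul_pow]
    exact hL _

theorem posMultipliers_algebraMap (hL : ∀ q, 0 ≤ L (q ^ 2)) {c : ℝ} (hc : 0 ≤ c) :
    algebraMap ℝ A c ∈ posMultipliers L := by
  rw [Algebra.algebraMap_eq_smul_one]
  refine posMultipliers_smul ?_ hc
  simpa using posMultipliers_sq hL 1

theorem apply_nonneg_of_mem_posMultipliers {a : A} (ha : a ∈ posMultipliers L) : 0 ≤ L a := by
  simpa using ha 1

theorem apply_mul_sq_le (hL : ∀ q, 0 ≤ L (q ^ 2)) (a b : A) :
    L (a * b) ^ 2 ≤ L (a ^ 2) * L (b ^ 2) := by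
  have h : ∀ t : ℝ, 0 ≤ L (b ^ 2) * (t * t) + 2 * L (a * b) * t + L (a ^ 2) := fun t => by
    have := hL (a + t • b)
    have e : (a + t • b) ^ 2 = (t * t) • b ^ 2 + (2 * t) • (a * b) + a ^ 2 := by
      simp only [Algebra.smul_def, map_mul, map_ofNat]
      ring
    rw [e] at this
    simp only [map_add, map_smul, smul_eq_mul] at this
    linarith
  have := discrim_le_zero h
  simp only [discrim] at this
  nlinarith

/-- The sequence `b, b - b², …` with `b_{k+1} = b_k - b_k²`. -/
def subSqIter (b : A) : ℕ → A
  | 0 => b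
  | k + 1 => subSqIter b k - subSqIter b k ^ 2

theorem subSqIter_mem {b : A} (hL : ∀ q, 0 ≤ L (q ^ 2)) (hb : b ∈ posMultipliers L)
    (hb' : 1 - b ∈ posMultipliers L) (k : ℕ) :
    subSqIter b k ∈ posMultipliers L ∧ 1 - subSqIter b k ∈ posMultipliers L := by
  induction k with
  | zero => exact ⟨hb, hb'⟩
  | succ k ih =>
    set c := subSqIter b k
    refine ⟨?_, ?_⟩
    -- Products of multipliers are not yet available, so `c (1 - c)` is split into multipliers times
    -- squares.
    · have : subSqIter b (k + 1) = (1 - c) * c ^ 2 + c * (1 - c) ^ 2 := by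
        simp only [subSqIter, c]; ring
      rw [this]
      exact posMultipliers_add (posMultipliers_mul_sq ih.2 _) (posMultipliers_mul_sq ih.1 _)
    · have : 1 - subSqIter b (k + 1) = (1 - c) + c ^ 2 := by
        simp only [subSqIter, c]; ring
      rw [this]
      exact posMultipliers_add ih.2 (posMultipliers_sq hL _)

omit [Algebra ℝ A] in
theorem eq_sum_sq_add_subSqIter (b : A) (k : ℕ) :
    b = ∑ i ∈ Finset.range k, subSqIter b i ^ 2 + subSqIter b k := by
  induction k with
  | zero => simp [subSqIter]
  | succ k ih =>
    conv_lhs => rw [ih]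
    rw [Finset.sum_range_succ, subSqIter]
    ring

/-- Write `b = ∑ b_i² + b_k` by telescoping. The terms `L (a b_i² q²)` are nonnegative. The series
of `L (b_i² q²)` is bounded by `L (b q²)`, so its terms tend to 0, and Cauchy–Schwarz then kills the
remainder `L (a b_k q²)`. -/
theorem posMultipliers_mul_of_le_one {a b : A} (hL : ∀ q, 0 ≤ L (q ^ 2))
    (ha : a ∈ posMultipliers L) (hb : b ∈ posMultipliers L) (hb' : 1 - b ∈ posMultipliers L) :
    a * b ∈ posMultipliers L := fun q => by
  have hlim : Tendsto (fun k => L ((subSqIter b k * q) ^ 2)) atTop (𝓝 0) := by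
    refine (summable_of_sum_range_le (c := L (b * q ^ 2)) (fun k => hL _)
      fun k => ?_).tendsto_atTop_zero
    have h := congrArg (fun t => L (t * q ^ 2)) (eq_sum_sq_add_subSqIter b k)
    simp only [add_mul, map_add, Finset.sum_mul, map_sum] at h
    rw [h]
    simp only [mul_pow]
    exact le_add_of_nonneg_right ((subSqIter_mem hL hb hb' k).1 q)
  have hrem : Tendsto (fun k => L (a * subSqIter b k * q ^ 2)) atTop (𝓝 0) := by
    have h2 : Tendsto (fun k => Real.sqrt (L ((a * q) ^ 2) * L ((subSqIter b k * q) ^ 2))) atTop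
        (𝓝 0) := by
      simpa using (hlim.const_mul (L ((a * q) ^ 2))).sqrt
    refine squeeze_zero_norm (fun k => ?_) h2
    refine Real.abs_le_sqrt ?_
    have := apply_mul_sq_le hL (a * q) (subSqIter b k * q)
    rwa [show a * q * (subSqIter b k * q) = a * subSqIter b k * q ^ 2 by ring] at this
  refine le_of_tendsto hrem (Eventually.of_forall fun k => ?_)
  have h := congrArg (fun t => L (a * t * q ^ 2)) (eq_sum_sq_add_subSqIter b k)
  simp only [mul_add, add_mul, map_add, Finset.mul_sum, Finset.sum_mul, map_sum] at h
  rw [h]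
  exact le_add_of_nonneg_left (Finset.sum_nonneg fun i _ => posMultipliers_mul_sq ha _ q)

theorem posMultipliers_mul {a b : A} {c : ℝ} (hc : 0 < c) (hL : ∀ q, 0 ≤ L (q ^ 2))
    (ha : a ∈ posMultipliers L) (hb : b ∈ posMultipliers L)
    (hb' : algebraMap ℝ A c - b ∈ posMultipliers L) : a * b ∈ posMultipliers L := by
  have h := posMultipliers_mul_of_le_one hL ha (posMultipliers_smul hb (inv_nonneg.2 hc.le)) (by
    have := posMultipliers_smul hb' (inv_nonneg.2 hc.le)
    rwa [smul_sub, Algebra.algebraMap_eq_smul_one, inv_smul_smul₀ hc.ne'] at this)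
  have := posMultipliers_smul h hc.le
  rwa [mul_smul_comm, smul_inv_smul₀ hc.ne'] at this

/-- `a` is bounded, in the order defined by the multipliers, by a positive constant. -/
def IsBoundedBy (L : A →ₗ[ℝ] ℝ) (a : A) (c : ℝ) : Prop :=
  0 < c ∧ algebraMap ℝ A c - a ∈ posMultipliers L ∧ algebraMap ℝ A c + a ∈ posMultipliers L

theorem isBoundedBy_algebraMap (hL : ∀ q, 0 ≤ L (q ^ 2)) (r : ℝ) :
    IsBoundedBy L (algebraMap ℝ A r) (|r| + 1) := by
  refine ⟨by positivity, ?_, ?_⟩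
  · rw [← map_sub]
    exact posMultipliers_algebraMap hL (by linarith [le_abs_self r])
  · rw [← map_add]
    exact posMultipliers_algebraMap hL (by linarith [neg_abs_le r])

theorem IsBoundedBy.add {a b : A} {c d : ℝ} (ha : IsBoundedBy L a c) (hb : IsBoundedBy L b d) :
    IsBoundedBy L (a + b) (c + d) := by
  refine ⟨add_pos ha.1 hb.1, ?_, ?_⟩
  · have := posMultipliers_add ha.2.1 hb.2.1
    rwa [show algebraMap ℝ A (c + d) - (a + b) = algebraMap ℝ A c - a + (algebraMap ℝ A d - b) by
      rw [map_add]; ring]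
  · have := posMultipliers_add ha.2.2 hb.2.2
    rwa [show algebraMap ℝ A (c + d) + (a + b) = algebraMap ℝ A c + a + (algebraMap ℝ A d + b) by
      rw [map_add]; ring]

/-- Both `2 (cd - ab)` and `2 (cd + ab)` are sums of two products `(c ± a)(d ± b)` of multipliers;
the second factors are bounded above by `2 d`, as `posMultipliers_mul` requires. -/
theorem IsBoundedBy.mul {a b : A} {c d : ℝ} (hL : ∀ q, 0 ≤ L (q ^ 2)) (ha : IsBoundedBy L a c)
    (hb : IsBoundedBy L b d) : IsBoundedBy L (a * b) (c * d) := by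
  have h2 : algebraMap ℝ A (2 * d) = algebraMap ℝ A d + algebraMap ℝ A d := by
    rw [two_mul, map_add]
  have hd : 0 < 2 * d := by linarith [hb.1]
  have hp : algebraMap ℝ A (2 * d) - (algebraMap ℝ A d + b) ∈ posMultipliers L := by
    rw [h2, show ∀ x : A, x + x - (x + b) = x - b from fun x => by ring]
    exact hb.2.1
  have hm : algebraMap ℝ A (2 * d) - (algebraMap ℝ A d - b) ∈ posMultipliers L := by
    rw [h2, show ∀ x : A, x + x - (x - b) = x + b from fun x => by ring]
    exact hb.2.2
  have hhalf : ∀ x : A, (1 / 2 : ℝ) • (2 * x) = x := fun x => by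
    rw [two_mul, ← two_smul ℝ x, smul_smul]; norm_num
  refine ⟨mul_pos ha.1 hb.1, ?_, ?_⟩
  · have := posMultipliers_smul (c := 1 / 2) (posMultipliers_add
      (posMultipliers_mul hd hL ha.2.1 hb.2.2 hp) (posMultipliers_mul hd hL ha.2.2 hb.2.1 hm))
      (by norm_num)
    rwa [← hhalf (algebraMap ℝ A (c * d) - a * b), show 2 * (algebraMap ℝ A (c * d) - a * b) =
      (algebraMap ℝ A c - a) * (algebraMap ℝ A d + b)
        + (algebraMap ℝ A c + a) * (algebraMap ℝ A d - b) by rw [map_mul]; ring]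
  · have := posMultipliers_smul (c := 1 / 2) (posMultipliers_add
      (posMultipliers_mul hd hL ha.2.1 hb.2.1 hm) (posMultipliers_mul hd hL ha.2.2 hb.2.2 hp))
      (by norm_num)
    rwa [← hhalf (algebraMap ℝ A (c * d) + a * b), show 2 * (algebraMap ℝ A (c * d) + a * b) =
      (algebraMap ℝ A c - a) * (algebraMap ℝ A d - b)
        + (algebraMap ℝ A c + a) * (algebraMap ℝ A d + b) by rw [map_mul]; ring]

/-- `c + 1/4 ∓ a = (c - a²) + (a ∓ 1/2)²`. -/
theorem isBoundedBy_of_sq {a : A} {c : ℝ} (hL : ∀ q, 0 ≤ L (q ^ 2)) (hc : 0 < c)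
    (h : algebraMap ℝ A c - a ^ 2 ∈ posMultipliers L) : IsBoundedBy L a (c + 1 / 4) := by
  have h4 : algebraMap ℝ A (c + 1 / 4) = algebraMap ℝ A c + algebraMap ℝ A (1 / 2) ^ 2 := by
    rw [← map_pow, ← map_add]; norm_num
  have h22 : ∀ x : A, 2 * algebraMap ℝ A (1 / 2) * x = x := fun x => by
    rw [← map_ofNat (algebraMap ℝ A) 2, ← map_mul]; norm_num
  refine ⟨by linarith, ?_, ?_⟩
  · have := posMultipliers_add h (posMultipliers_sq hL (a - algebraMap ℝ A (1 / 2)))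
    convert this using 1
    rw [h4]
    linear_combination h22 a
  · have := posMultipliers_add h (posMultipliers_sq hL (a + algebraMap ℝ A (1 / 2)))
    convert this using 1
    rw [h4]
    linear_combination - h22 a

/-- The normalized linear functionals that are nonnegative on the multipliers of `L`. -/
def states (L : A →ₗ[ℝ] ℝ) : Set (A → ℝ) :=
  {φ | (∀ a b, φ (a + b) = φ a + φ b) ∧ (∀ (c : ℝ) a, φ (c • a) = c * φ a) ∧ φ 1 = 1 ∧
    ∀ a ∈ posMultipliers L, 0 ≤ φ a}

theorem states_abs_le {φ : A → ℝ} (hφ : φ ∈ states L) {a : A} {c : ℝ} (ha : IsBoundedBy L a c) :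
    |φ a| ≤ c := by
  obtain ⟨h1, h2, h3, h4⟩ := hφ
  have hp := h4 _ ha.2.2
  have hm := h4 _ ha.2.1
  have hn : φ (-a) = - φ a := by have := h2 (-1) a; simpa using this
  rw [Algebra.algebraMap_eq_smul_one] at hp hm
  rw [sub_eq_add_neg, h1, h2, h3, hn] at hm
  rw [h1, h2, h3] at hp
  rw [abs_le]
  constructor <;> linarith

/-- As in Banach–Alaoglu: the states form a closed subset of a product of compact intervals, in the
topology of pointwise convergence. -/
theorem isCompact_states (hbd : ∀ a : A, ∃ c, IsBoundedBy L a c) : IsCompact (states L) := by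
  choose c hc using hbd
  refine (isCompact_univ_pi fun a => isCompact_Icc (a := -c a) (b := c a)).of_isClosed_subset ?_
    fun φ hφ a _ => abs_le.1 (states_abs_le hφ (hc a))
  have hev : ∀ a : A, Continuous fun φ : A → ℝ => φ a := fun a => continuous_apply a
  have : states L = (⋂ (a) (b), {φ | φ (a + b) = φ a + φ b}) ∩
      ((⋂ (c : ℝ) (a), {φ | φ (c • a) = c * φ a}) ∩ ({φ | φ 1 = 1} ∩
        ⋂ a ∈ posMultipliers L, {φ | 0 ≤ φ a})) := by
    ext φ; simp [states]
  rw [this]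
  refine (isClosed_iInter fun a => isClosed_iInter fun b =>
    isClosed_eq (hev _) ((hev _).add (hev _))).inter ((isClosed_iInter fun c => isClosed_iInter
      fun a => isClosed_eq (hev _) ((hev _).const_mul _)).inter
      ((isClosed_eq (hev _) continuous_const).inter (isClosed_biInter fun a _ =>
        isClosed_le continuous_const (hev _))))

theorem states_mul_of_pos {φ : A → ℝ} (hφ : φ ∈ states L) {a : A} (ht : 0 < φ a)
    (hmul : ∀ b ∈ posMultipliers L, a * b ∈ posMultipliers L) :
    (fun b => (φ a)⁻¹ * φ (a * b)) ∈ states L := by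
  obtain ⟨h1, h2, h3, h4⟩ := hφ
  refine ⟨fun b c => ?_, fun c b => ?_, ?_, fun b hb => ?_⟩
  · simp only [mul_add, h1]
  · simp only [mul_smul_comm, h2]; ring
  · simp [ht.ne']
  · exact mul_nonneg (inv_nonneg.2 ht.le) (h4 _ (hmul b hb))

theorem states_mul_eq_zero (hL : ∀ q, 0 ≤ L (q ^ 2)) (hbd : ∀ a : A, ∃ c, IsBoundedBy L a c)
    {φ : A → ℝ} (hφ : φ ∈ states L) {a : A} (ha : a ∈ posMultipliers L) (h0 : φ a = 0) (b : A) :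
    φ (a * b) = 0 := by
  obtain ⟨c, hc, hm, hp⟩ := hbd b
  obtain ⟨d, hd, had, -⟩ := hbd a
  obtain ⟨h1, h2, h3, h4⟩ := hφ
  have hp := h4 _ (posMultipliers_mul hd hL hp ha had)
  have hm := h4 _ (posMultipliers_mul hd hL hm ha had)
  have hn : φ (-(a * b)) = - φ (a * b) := by have := h2 (-1) (a * b); simpa using this
  rw [show (algebraMap ℝ A c - b) * a = c • a + (-(a * b)) by rw [Algebra.smul_def]; ring, h1, h2,
    hn, h0] at hm
  rw [show (algebraMap ℝ A c + b) * a = c • a + (a * b) by rw [Algebra.smul_def]; ring, h1, h2,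
    h0] at hp
  linarith

/-- If `0 < φ a < 1`, then `φ` is the convex combination, with weights `φ a` and `1 - φ a`, of the
states `φ (a ·) / φ a` and `φ ((1 - a) ·) / φ (1 - a)`; extremality forces the first to equal `φ`.
The cases `φ a = 0` and `φ a = 1` come from `states_mul_eq_zero`. -/
theorem extreme_state_mul_of_mem (hL : ∀ q, 0 ≤ L (q ^ 2))
    (hbd : ∀ a : A, ∃ c, IsBoundedBy L a c) {φ : A → ℝ} (hφ : φ ∈ (states L).extremePoints ℝ)
    {a : A} (ha : a ∈ posMultipliers L) (ha' : 1 - a ∈ posMultipliers L) (b : A) :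
    φ (a * b) = φ a * φ b := by
  obtain ⟨hφS, hext⟩ := hφ
  have h1 := hφS.1
  have h2 := hφS.2.1
  have h3 := hφS.2.2.1
  have hsub : ∀ x, φ ((1 - a) * x) = φ x - φ (a * x) := fun x => by
    have := h1 ((1 - a) * x) (a * x)
    rw [show (1 - a) * x + a * x = x by ring] at this
    linarith
  have hsub1 : φ (1 - a) = 1 - φ a := by simpa [h3] using hsub 1
  have ht0 : 0 ≤ φ a := hφS.2.2.2 a ha
  have ht1 : 0 ≤ 1 - φ a := hsub1 ▸ hφS.2.2.2 _ ha'
  rcases ht0.eq_or_lt with h0 | h0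
  · rw [states_mul_eq_zero hL hbd hφS ha h0.symm, ← h0, zero_mul]
  rcases ht1.eq_or_lt with h0' | h0'
  · have := states_mul_eq_zero hL hbd hφS ha' (hsub1.trans h0'.symm) b
    rw [hsub] at this
    rw [show φ a = 1 by linarith]
    linarith
  have m1 : ∀ b ∈ posMultipliers L, a * b ∈ posMultipliers L := fun b hb =>
    mul_comm b a ▸ posMultipliers_mul_of_le_one hL hb ha ha'
  have m2 : ∀ b ∈ posMultipliers L, (1 - a) * b ∈ posMultipliers L := fun b hb =>
    mul_comm b (1 - a) ▸ posMultipliers_mul_of_le_one hL hb ha' (by simpa using ha)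
  have e := hext (states_mul_of_pos hφS h0 m1) (states_mul_of_pos hφS (hsub1.symm ▸ h0') m2)
    ⟨φ a, 1 - φ a, h0, h0', by ring, by
      funext x
      simp only [Pi.add_apply, Pi.smul_apply, smul_eq_mul, hsub1, hsub]
      field_simp
      ring⟩
  have := congrFun e b
  rw [← this]
  field_simp

theorem extreme_state_mul (hL : ∀ q, 0 ≤ L (q ^ 2))
    (hbd : ∀ a : A, ∃ c, IsBoundedBy L a c) {φ : A → ℝ} (hφ : φ ∈ (states L).extremePoints ℝ)
    (a b : A) : φ (a * b) = φ a * φ b := by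
  obtain ⟨c, hc, hm, hp⟩ := hbd a
  have h1 := hφ.1.1
  have h2 := hφ.1.2.1
  have h3 := hφ.1.2.2.1
  have hc2 : 0 ≤ (2 * c)⁻¹ := by positivity
  -- The affine rescaling `(c + a) / (2c)` lies between 0 and 1, and multiplicativity passes back to
  -- `a`.
  have key := extreme_state_mul_of_mem hL hbd hφ (posMultipliers_smul hp hc2) (by
    convert posMultipliers_smul hm hc2 using 1
    have : (1 : A) = (2 * c)⁻¹ • (algebraMap ℝ A c + algebraMap ℝ A c) := by
      rw [← map_add, ← two_mul, Algebra.algebraMap_eq_smul_one, smul_smul,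
        inv_mul_cancel₀ (by positivity), one_smul]
    nth_rewrite 1 [this]
    rw [← smul_sub]
    congr 1
    ring) b
  rw [smul_mul_assoc, h2, h2, mul_assoc] at key
  have key := mul_left_cancel₀ (by positivity) key
  rw [add_mul, h1, h1, Algebra.algebraMap_eq_smul_one, smul_mul_assoc, one_mul, h2, h2, h3] at key
  linarith

/-- The Kadison–Dubois principle: a functional that is nonnegative on squares, and for which all
elements are bounded, is nonnegative on all elements on which the characters that are nonnegative
on its multipliers are nonnegative. -/
theorem apply_nonneg_of_forall_algHom (hL : ∀ q, 0 ≤ L (q ^ 2))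
    (hbd : ∀ a : A, ∃ c, IsBoundedBy L a c) {p : A}
    (hp : ∀ χ : A →ₐ[ℝ] ℝ, (∀ a ∈ posMultipliers L, 0 ≤ χ a) → 0 ≤ χ p) : 0 ≤ L p := by
  have h1 : 0 ≤ L 1 := by simpa using hL 1
  -- If `L 1 = 0`, Cauchy–Schwarz gives `L p = 0`; otherwise `L / L 1` is a state.
  rcases h1.eq_or_lt with h0 | h0
  · have := apply_mul_sq_le hL 1 p
    rw [one_mul, one_pow, ← h0, zero_mul] at this
    exact (pow_eq_zero_iff two_ne_zero).1 (le_antisymm this (sq_nonneg _)) ▸ le_rfl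
  have hmem : (fun a => (L 1)⁻¹ * L a) ∈ states L := by
    refine ⟨fun a b => ?_, fun c a => ?_, inv_mul_cancel₀ h0.ne', fun a ha => ?_⟩
    · simp only [map_add, mul_add]
    · simp only [map_smul, smul_eq_mul]; ring
    · exact mul_nonneg (inv_nonneg.2 h0.le) (apply_nonneg_of_mem_posMultipliers ha)
  have hcomp := isCompact_states hbd
  -- The minimizers of evaluation at `p` form a compact face of the states. By Krein–Milman this
  -- face has an extreme point, which is extreme among all states and therefore a character.
  obtain ⟨φ₀, hφ₀, hmin⟩ := hcomp.exists_isMinOn ⟨_, hmem⟩ (continuous_apply p).continuousOn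
  have hF : IsExtreme ℝ (states L) (states L ∩ {φ | φ p = φ₀ p}) := by
    refine ⟨Set.inter_subset_left, ?_⟩
    rintro φ hφ ψ hψ θ ⟨hθ, hθp⟩ ⟨s, t, hs, ht, hst, rfl⟩
    refine ⟨hφ, ?_⟩
    have a1 : φ₀ p ≤ φ p := hmin hφ
    have a2 : φ₀ p ≤ ψ p := hmin hψ
    simp only [Set.mem_ofPred_eq, Pi.add_apply, Pi.smul_apply, smul_eq_mul] at hθp ⊢
    have : s * (φ p - φ₀ p) + t * (ψ p - φ₀ p) = 0 := by
      linear_combination hθp - φ₀ p * hst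
    nlinarith [mul_nonneg hs.le (sub_nonneg.2 a1), mul_nonneg ht.le (sub_nonneg.2 a2)]
  obtain ⟨φ, hφ⟩ := (hcomp.inter_right (isClosed_eq (continuous_apply p)
    continuous_const)).extremePoints_nonempty ⟨φ₀, hφ₀, rfl⟩
  have hφp : φ p = φ₀ p := hφ.1.2
  have hφ := hF.extremePoints_subset_extremePoints hφ
  let χ : A →ₐ[ℝ] ℝ := AlgHom.ofLinearMap
    { toFun := φ, map_add' := hφ.1.1, map_smul' := hφ.1.2.1 } hφ.1.2.2.1
    (extreme_state_mul hL hbd hφ)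
  have h2 : 0 ≤ φ p := hp χ hφ.1.2.2.2
  have h3 : φ₀ p ≤ (L 1)⁻¹ * L p := hmin hmem
  have h4 : 0 ≤ (L 1)⁻¹ * L p := by linarith
  exact nonneg_of_mul_nonneg_right h4 (inv_pos.2 h0)

end PositiveFunctional

theorem isSumSq_mul_mem_posMultipliers {A : Type*} [CommRing A] [Algebra ℝ A] {L : A →ₗ[ℝ] ℝ}
    {a s : A} (ha : a ∈ posMultipliers L) (hs : IsSumSq s) : s * a ∈ posMultipliers L := by
  induction hs with
  | zero => intro q; simp
  | sq_add r _ ih =>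
    rw [add_mul]
    refine posMultipliers_add ?_ ih
    rw [← pow_two, mul_comm]
    exact posMultipliers_mul_sq ha r

/-! ### Archimedean quadratic modules and representing measures. -/

section Polynomials

variable {n m : ℕ} {g : Fin m → MvPolynomial (Fin n) ℝ}

theorem quadModule_subset_posMultipliers {L : MvPolynomial (Fin n) ℝ →ₗ[ℝ] ℝ}
    (hL : ∀ q, 0 ≤ L (q ^ 2)) (hg : ∀ j, g j ∈ posMultipliers L) :
    quadModule g ⊆ posMultipliers L := by
  rintro _ ⟨σ₀, σ, h₀, h, rfl⟩
  refine posMultipliers_add ?_ ?_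
  · have := isSumSq_mul_mem_posMultipliers (posMultipliers_sq hL 1) h₀
    simpa using this
  · refine Finset.sum_induction _ (· ∈ posMultipliers L) (fun a b => posMultipliers_add)
      (fun q => by simp) fun j _ => isSumSq_mul_mem_posMultipliers (hg j) (h j)

theorem isBoundedBy_X {L : MvPolynomial (Fin n) ℝ →ₗ[ℝ] ℝ} (hL : ∀ q, 0 ≤ L (q ^ 2)) {M : ℝ}
    (hM : 0 < M) (h : C M - ∑ i, X i ^ 2 ∈ posMultipliers L) (i : Fin n) :
    IsBoundedBy L (X i) (M + 1 / 4) := by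
  refine isBoundedBy_of_sq hL hM ?_
  have h2 : ∑ j ∈ Finset.univ.erase i, (X j : MvPolynomial (Fin n) ℝ) ^ 2 ∈ posMultipliers L :=
    Finset.sum_induction _ (· ∈ posMultipliers L) (fun a b => posMultipliers_add)
      (fun q => by simp) fun j _ => posMultipliers_sq hL _
  have := posMultipliers_add h h2
  rw [← Finset.add_sum_erase _ _ (Finset.mem_univ i)] at this
  convert this using 1
  rw [algebraMap_eq]
  ring

theorem exists_isBoundedBy {L : MvPolynomial (Fin n) ℝ →ₗ[ℝ] ℝ} (hL : ∀ q, 0 ≤ L (q ^ 2))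
    (hX : ∀ i, ∃ c, IsBoundedBy L (X i) c) (p : MvPolynomial (Fin n) ℝ) :
    ∃ c, IsBoundedBy L p c := by
  induction p using MvPolynomial.induction_on with
  | C a => exact ⟨_, isBoundedBy_algebraMap hL a⟩
  | add p q hp hq =>
    obtain ⟨c, hc⟩ := hp
    obtain ⟨d, hd⟩ := hq
    exact ⟨_, hc.add hd⟩
  | mul_X p i hp =>
    obtain ⟨c, hc⟩ := hp
    obtain ⟨d, hd⟩ := hX i
    exact ⟨_, hc.mul hL hd⟩

/-- A functional that is nonnegative on an Archimedean quadratic module is nonnegative on the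
polynomials that are nonnegative on `K`. -/
theorem apply_nonneg_of_nonneg_on_feasSet (h_arch : IsArchimedean g)
    {L : MvPolynomial (Fin n) ℝ →ₗ[ℝ] ℝ} (hL : ∀ q, 0 ≤ L (q ^ 2))
    (hg : ∀ j, g j ∈ posMultipliers L) {p : MvPolynomial (Fin n) ℝ}
    (hp : ∀ x ∈ feasSet g, 0 ≤ eval x p) : 0 ≤ L p := by
  obtain ⟨M, hM, hMg⟩ := h_arch
  have hX := isBoundedBy_X hL hM (quadModule_subset_posMultipliers hL hg hMg)
  refine apply_nonneg_of_forall_algHom hL (exists_isBoundedBy hL fun i => ⟨_, hX i⟩) fun χ hχ => ?_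
  -- A character of the polynomial ring is evaluation at a point; nonnegativity on the multipliers
  -- `g j` puts this point in `K`.
  have hχe : ∀ q, χ q = eval (fun i => χ (X i)) q := fun q => by
    conv_lhs => rw [aeval_unique χ]
    rw [aeval_eq_eval]
    rfl
  rw [hχe]
  exact hp _ fun j => by rw [← hχe]; exact hχ _ (hg j)

theorem eval_nonneg_of_isSumSq {s : MvPolynomial (Fin n) ℝ} (hs : IsSumSq s) (x : Fin n → ℝ) :
    0 ≤ eval x s := by
  induction hs with
  | zero => simp
  | sq_add r _ ih =>
    rw [map_add, map_mul]
    exact add_nonneg (mul_self_nonneg _) ih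

theorem eval_nonneg_of_mem_quadModule {p : MvPolynomial (Fin n) ℝ} (hp : p ∈ quadModule g)
    {x : Fin n → ℝ} (hx : x ∈ feasSet g) : 0 ≤ eval x p := by
  obtain ⟨σ₀, σ, h₀, h, rfl⟩ := hp
  rw [map_add, map_sum]
  refine add_nonneg (eval_nonneg_of_isSumSq h₀ x) (Finset.sum_nonneg fun j _ => ?_)
  rw [map_mul]
  exact mul_nonneg (eval_nonneg_of_isSumSq (h j) x) (hx j)

theorem isClosed_feasSet (g : Fin m → MvPolynomial (Fin n) ℝ) : IsClosed (feasSet g) := by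
  have : feasSet g = ⋂ j, {x | 0 ≤ eval x (g j)} := by ext; simp [feasSet]
  rw [this]
  exact isClosed_iInter fun j => isClosed_le continuous_const (continuous_eval (g j))

theorem isCompact_feasSet (h_arch : IsArchimedean g) : IsCompact (feasSet g) := by
  obtain ⟨M, hM, hMg⟩ := h_arch
  refine (isCompact_univ_pi fun i => isCompact_Icc (a := -√M) (b := √M)).of_isClosed_subset
    (isClosed_feasSet g) fun x hx i _ => abs_le.1 (Real.abs_le_sqrt ?_)
  have := eval_nonneg_of_mem_quadModule hMg hx
  simp only [map_sub, eval_C, map_sum, map_pow, eval_X] at this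
  have h := Finset.single_le_sum (f := fun i => x i ^ 2) (fun i _ => sq_nonneg _)
    (Finset.mem_univ i)
  exact h.trans (by linarith)

/-- A positive functional on polynomials, on a compact set, is integration against a measure. -/
theorem exists_measure_of_nonneg {K : Set (Fin n → ℝ)} (hK : IsCompact K)
    {L : MvPolynomial (Fin n) ℝ →ₗ[ℝ] ℝ} (hL : ∀ p, (∀ x ∈ K, 0 ≤ eval x p) → 0 ≤ L p) :
    ∃ μ : Measure (Fin n → ℝ), IsFiniteMeasure μ ∧ μ Kᶜ = 0 ∧
      ∀ p, ∫ x in K, eval x p ∂μ = L p := by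
  have : CompactSpace K := isCompact_iff_compactSpace.1 hK
  let r : MvPolynomial (Fin n) ℝ →ₗ[ℝ] C(K, ℝ) :=
    { toFun := fun p => ⟨fun x => eval x.1 p, (continuous_eval p).comp continuous_subtype_val⟩
      map_add' := fun p q => by ext; simp
      map_smul' := fun c p => by ext; simp [smul_eval] }
  have hr : ∀ p (x : K), r p x = eval x.1 p := fun p x => rfl
  -- `L` vanishes on polynomials that vanish on `K`, hence descends to polynomial functions on `K`.
  have hker : LinearMap.ker r ≤ LinearMap.ker L := fun p hp => by
    have h0 : ∀ x ∈ K, eval x p = 0 := fun x hx => by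
      rw [← hr p ⟨x, hx⟩, LinearMap.mem_ker.1 hp]; rfl
    have h1 := hL p fun x hx => (h0 x hx).ge
    have h2 := hL (-p) fun x hx => by rw [map_neg, h0 x hx, neg_zero]
    rw [map_neg] at h2
    exact LinearMap.mem_ker.2 (le_antisymm (by linarith) h1)
  let F : C(K, ℝ) →ₗ.[ℝ] ℝ :=
    { domain := LinearMap.range r
      toFun := (LinearMap.ker r).liftQ L hker ∘ₗ r.quotKerEquivRange.symm.toLinearMap }
  have hF : ∀ p (hp : r p ∈ F.domain), F ⟨r p, hp⟩ = L p := fun p hp => by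
    have : r.quotKerEquivRange.symm ⟨r p, hp⟩ = Submodule.Quotient.mk p := by
      rw [LinearEquiv.symm_apply_eq]; rfl
    change (LinearMap.ker r).liftQ L hker (r.quotKerEquivRange.symm ⟨r p, hp⟩) = _
    rw [this]; rfl
  -- Positive extension to `C(K, ℝ)` is possible because the constant `‖y‖` dominates `-y`.
  -- Riesz–Markov then represents the extension, so no density argument is needed.
  obtain ⟨G, hG1, hG2⟩ := riesz_extension (PointedCone.positive ℝ C(K, ℝ)) F (by
      rintro ⟨_, p, rfl⟩ hp
      exact (hL p fun x hx => hp ⟨x, hx⟩).trans_eq (hF p ⟨p, rfl⟩).symm) (fun y => by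
      refine ⟨⟨r (C ‖y‖), _, rfl⟩, fun x => ?_⟩
      have := neg_le_of_abs_le (y.norm_coe_le_norm x)
      change 0 ≤ eval x.1 (C ‖y‖) + y x
      rw [eval_C]
      linarith)
  let Λ : CompactlySupportedContinuousMap K ℝ →ₚ[ℝ] ℝ := PositiveLinearMap.mk₀
    { toFun := fun φ => G φ.toContinuousMap
      map_add' := fun φ ψ => by rw [← map_add]; rfl
      map_smul' := fun c φ => by rw [← map_smul]; rfl } fun φ hφ => hG2 _ hφ
  have hint := RealRMK.integral_rieszMeasure Λ
  set ν := RealRMK.rieszMeasure Λ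
  have hν : IsFiniteMeasure ν := inferInstance
  refine ⟨ν.map Subtype.val, inferInstance, ?_, fun p => ?_⟩
  · rw [Measure.map_apply measurable_subtype_coe hK.measurableSet.compl]
    simp
  · have he : MeasurableEmbedding (Subtype.val : K → Fin n → ℝ) :=
      MeasurableEmbedding.subtype_coe hK.measurableSet
    rw [he.setIntegral_map]
    simp only [Subtype.coe_preimage_self, Measure.restrict_univ]
    have h1 := hint (CompactlySupportedContinuousMap.continuousMapEquiv (r p))
    have h2 := hG1 ⟨r p, p, rfl⟩
    exact h1.trans (h2.trans (hF p ⟨p, rfl⟩))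

end Polynomials

/-! ### Moment and localizing matrices as quadratic forms. -/

section Riesz

variable {n : ℕ}

/-- The linear functional `L_z` as a linear map. -/
noncomputable def rieszLin (z : (Fin n →₀ ℕ) → ℝ) : MvPolynomial (Fin n) ℝ →ₗ[ℝ] ℝ :=
  (basisMonomials (Fin n) ℝ).constr ℝ z

theorem rieszLin_monomial (z : (Fin n →₀ ℕ) → ℝ) (α : Fin n →₀ ℕ) (c : ℝ) :
    rieszLin z (monomial α c) = c * z α := by
  have h := (basisMonomials (Fin n) ℝ).constr_basis ℝ z α
  rw [coe_basisMonomials] at h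
  rw [← mul_one c, ← smul_eq_mul c 1, ← smul_monomial, map_smul, rieszLin, h, smul_eq_mul,
    smul_eq_mul, mul_one]

theorem rieszFun_eq_rieszLin (z : (Fin n →₀ ℕ) → ℝ) (p : MvPolynomial (Fin n) ℝ) :
    rieszFun z p = rieszLin z p := by
  conv_rhs => rw [p.as_sum]
  rw [map_sum]
  simp only [rieszLin_monomial, rieszFun]

theorem eq_sum_monomial_multiIdx {p : MvPolynomial (Fin n) ℝ} {d : ℕ} (hp : p.totalDegree ≤ d) :
    p = ∑ α ∈ multiIdx n d, monomial α (p.coeff α) := by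
  conv_lhs => rw [p.as_sum]
  refine Finset.sum_subset (fun α hα => mem_multiIdx.2 ?_) fun α _ hα => ?_
  · exact (le_totalDegree hα).trans hp
  · rw [notMem_support_iff.1 hα, map_zero]

theorem localizingMatrix_apply (d : ℕ) (p : MvPolynomial (Fin n) ℝ) (z : (Fin n →₀ ℕ) → ℝ)
    (α β : multiIdx n d) :
    localizingMatrix d p z α β = rieszLin z (p * monomial (α.1 + β.1) 1) := by
  conv_rhs => rw [p.as_sum]
  simp only [Finset.sum_mul, monomial_mul, map_sum, rieszLin_monomial, mul_one, localizingMatrix,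
    Matrix.of_apply, add_comm]

/-- `L_z(p q²)` is the quadratic form of the localizing matrix at the coefficient vector of `q`. -/
theorem rieszLin_mul_sq_nonneg {d : ℕ} {p q : MvPolynomial (Fin n) ℝ} {z : (Fin n →₀ ℕ) → ℝ}
    (h : (localizingMatrix d p z).PosSemidef) (hq : q.totalDegree ≤ d) :
    0 ≤ rieszLin z (p * q ^ 2) := by
  have := h.dotProduct_mulVec_nonneg fun α => q.coeff α.1
  have e : rieszLin z (p * q ^ 2) = ∑ α : multiIdx n d, ∑ β : multiIdx n d,
      q.coeff α.1 * q.coeff β.1 * rieszLin z (p * monomial (α.1 + β.1) 1) := by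
    have hq' : q = ∑ α : multiIdx n d, monomial α.1 (q.coeff α.1) := by
      rw [Finset.sum_coe_sort (multiIdx n d) fun α => monomial α (q.coeff α)]
      exact eq_sum_monomial_multiIdx hq
    have hs : q ^ 2 = ∑ α : multiIdx n d, ∑ β : multiIdx n d,
        (q.coeff α.1 * q.coeff β.1) • monomial (α.1 + β.1) 1 := by
      rw [pow_two]
      conv_lhs => rw [hq']
      simp only [Finset.sum_mul_sum, monomial_mul, smul_monomial, smul_eq_mul, mul_one]
    rw [hs]
    simp only [Finset.mul_sum, map_sum, mul_smul_comm, map_smul, smul_eq_mul]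
  rw [e]
  refine this.trans_eq ?_
  simp only [dotProduct, Matrix.mulVec, localizingMatrix_apply, Pi.star_apply, star_trivial,
    Finset.mul_sum]
  refine Finset.sum_congr rfl fun α _ => Finset.sum_congr rfl fun β _ => ?_
  ring

theorem momentMatrix_eq_localizingMatrix (d : ℕ) (z : (Fin n →₀ ℕ) → ℝ) :
    momentMatrix d z = localizingMatrix d 1 z := by
  ext α β
  rw [localizingMatrix_apply, one_mul, rieszLin_monomial, one_mul]
  rfl

end Riesz

/-! ### Limits of functionals that are only eventually positive. -/

section Limit

variable {n m : ℕ} {g : Fin m → MvPolynomial (Fin n) ℝ} {ι : Type*} {l : Filter ι}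
  {Λ : ι → MvPolynomial (Fin n) ℝ →ₗ[ℝ] ℝ}

theorem eventually_nonneg_isSumSq_mul {a s : MvPolynomial (Fin n) ℝ}
    (ha : ∀ q, ∀ᶠ d in l, 0 ≤ Λ d (a * q ^ 2)) (hs : IsSumSq s) (q : MvPolynomial (Fin n) ℝ) :
    ∀ᶠ d in l, 0 ≤ Λ d (s * a * q ^ 2) := by
  induction hs with
  | zero => simp
  | sq_add r _ ih =>
    filter_upwards [ih, ha (r * q)] with d h1 h2
    rw [add_mul, add_mul, map_add, show r * r * a * q ^ 2 = a * (r * q) ^ 2 by ring]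
    exact add_nonneg h2 h1

theorem eventually_nonneg_of_mem_quadModule (hL : ∀ q, ∀ᶠ d in l, 0 ≤ Λ d (q ^ 2))
    (hg : ∀ j q, ∀ᶠ d in l, 0 ≤ Λ d (g j * q ^ 2)) {p : MvPolynomial (Fin n) ℝ}
    (hp : p ∈ quadModule g) (q : MvPolynomial (Fin n) ℝ) :
    ∀ᶠ d in l, 0 ≤ Λ d (p * q ^ 2) := by
  obtain ⟨σ₀, σ, h₀, h, rfl⟩ := hp
  have h1 := eventually_nonneg_isSumSq_mul (a := 1) (by simpa using hL) h₀ q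
  have h2 := eventually_all.2 fun j => eventually_nonneg_isSumSq_mul (hg j) (h j) q
  filter_upwards [h1, h2] with d h1 h2
  rw [add_mul, map_add, Finset.sum_mul, map_sum]
  rw [mul_one] at h1
  exact add_nonneg h1 (Finset.sum_nonneg fun j _ => h2 j)

/-- Induction on `q`, starting from the bound on `Λ d 1`. Sums use `(p + q)² ≤ 2p² + 2q²`;
multiplication by a variable uses `∑ Λ d ((p X_j)²) ≤ M Λ d (p²)`, which is the Archimedean element
tested against `p`. -/
theorem exists_eventually_apply_sq_le (h_arch : IsArchimedean g)
    (hL : ∀ q, ∀ᶠ d in l, 0 ≤ Λ d (q ^ 2)) (hg : ∀ j q, ∀ᶠ d in l, 0 ≤ Λ d (g j * q ^ 2))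
    {c : ℝ} (hc : ∀ᶠ d in l, Λ d 1 ≤ c) (q : MvPolynomial (Fin n) ℝ) :
    ∃ b, ∀ᶠ d in l, Λ d (q ^ 2) ≤ b := by
  obtain ⟨M, hM, hMg⟩ := h_arch
  induction q using MvPolynomial.induction_on with
  | C a =>
    refine ⟨a ^ 2 * c, hc.mono fun d hd => ?_⟩
    rw [← map_pow, C_eq_smul_one, map_smul, smul_eq_mul]
    exact mul_le_mul_of_nonneg_left hd (sq_nonneg a)
  | add p q hp hq =>
    obtain ⟨b, hb⟩ := hp
    obtain ⟨b', hb'⟩ := hq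
    refine ⟨2 * b + 2 * b', ?_⟩
    filter_upwards [hb, hb', hL (p - q)] with d h1 h2 h3
    have : (p + q) ^ 2 + (p - q) ^ 2 = (2 : ℝ) • p ^ 2 + (2 : ℝ) • q ^ 2 := by
      simp only [two_smul]; ring
    have := congrArg (Λ d) this
    simp only [map_add, map_smul, smul_eq_mul] at this
    linarith
  | mul_X p i hp =>
    obtain ⟨b, hb⟩ := hp
    refine ⟨M * b, ?_⟩
    filter_upwards [hb, eventually_nonneg_of_mem_quadModule hL hg hMg p,
      eventually_all.2 fun j => hL (p * X j)] with d h1 h2 h3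
    rw [sub_mul, Finset.sum_mul, map_sub, map_sum, ← smul_eq_C_mul, map_smul, smul_eq_mul,
      sub_nonneg] at h2
    simp only [← mul_pow, mul_comm _ p] at h2
    exact (Finset.single_le_sum (f := fun j => Λ d ((p * X j) ^ 2)) (fun j _ => h3 j)
      (Finset.mem_univ i)).trans (h2.trans (mul_le_mul_of_nonneg_left h1 hM.le))

theorem exists_eventually_abs_apply_le (h_arch : IsArchimedean g)
    (hL : ∀ q, ∀ᶠ d in l, 0 ≤ Λ d (q ^ 2)) (hg : ∀ j q, ∀ᶠ d in l, 0 ≤ Λ d (g j * q ^ 2))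
    {c : ℝ} (hc : ∀ᶠ d in l, Λ d 1 ≤ c) (q : MvPolynomial (Fin n) ℝ) :
    ∃ b, ∀ᶠ d in l, Λ d q ∈ Set.Icc (-b) b := by
  obtain ⟨b, hb⟩ := exists_eventually_apply_sq_le h_arch hL hg hc q
  refine ⟨c + b, ?_⟩
  -- Positivity on `(1 ± q)²` gives `2 |Λ d q| ≤ Λ d 1 + Λ d (q²)`.
  filter_upwards [hc, hb, hL (1 + q), hL (1 - q), hL 1, hL q] with d h1 h2 h3 h4 h5 h6
  rw [show (1 + q) ^ 2 = 1 + q + q + q ^ 2 by ring] at h3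
  rw [show (1 - q) ^ 2 = 1 - q - q + q ^ 2 by ring] at h4
  simp only [map_add, map_sub, one_pow] at h3 h4 h5
  constructor <;> linarith

/-- Along an ultrafilter every bounded family converges, so all limits exist at once without
extracting diagonal subsequences; linearity is uniqueness of limits. -/
theorem exists_tendsto_linearMap {U : Ultrafilter ι}
    (hb : ∀ p, ∃ b, ∀ᶠ d in (U : Filter ι), Λ d p ∈ Set.Icc (-b) b) :
    ∃ L : MvPolynomial (Fin n) ℝ →ₗ[ℝ] ℝ, ∀ p, Tendsto (fun d => Λ d p) U (𝓝 (L p)) := by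
  have : ∀ p, ∃ x, Tendsto (fun d => Λ d p) U (𝓝 x) := fun p => by
    obtain ⟨b, hb⟩ := hb p
    obtain ⟨x, -, hx⟩ := (isCompact_Icc (a := -b) (b := b)).ultrafilter_le_nhds
      (U.map fun d => Λ d p) (le_principal_iff.2 hb)
    exact ⟨x, hx⟩
  choose L hL using this
  refine ⟨⟨⟨L, fun p q => ?_⟩, fun c p => ?_⟩, hL⟩
  · refine tendsto_nhds_unique (hL (p + q)) ?_
    simpa using (hL p).add (hL q)
  · refine tendsto_nhds_unique (hL (c • p)) ?_
    simpa using (hL p).const_mul c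

end Limit

/-! ### Duality between coefficient norms and moment constraints. -/

section CoeffNorm

variable {n : ℕ}

theorem coeffNorm_nonneg (d : ℕ) (k : NormIdx) (p : MvPolynomial (Fin n) ℝ) :
    0 ≤ coeffNorm d k p := by
  cases k with
  | one => exact Finset.sum_nonneg fun _ _ => abs_nonneg _
  | infty =>
    obtain ⟨α, hα⟩ := multiIdx_nonempty n d
    exact (abs_nonneg _).trans (Finset.le_sup' (fun α => |p.coeff α|) hα)

theorem abs_coeff_le_coeffNorm {d : ℕ} (k : NormIdx) (p : MvPolynomial (Fin n) ℝ)
    {α : Fin n →₀ ℕ} (hα : α ∈ multiIdx n d) : |p.coeff α| ≤ coeffNorm d k p := by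
  cases k with
  | one => exact Finset.single_le_sum (f := fun α => |p.coeff α|) (fun _ _ => abs_nonneg _) hα
  | infty => exact Finset.le_sup' (fun α => |p.coeff α|) hα

theorem eq_zero_of_coeffNorm_eq_zero {d : ℕ} {k : NormIdx} {p : MvPolynomial (Fin n) ℝ}
    (hp : p.totalDegree ≤ d) (h : coeffNorm d k p = 0) : p = 0 := by
  rw [eq_sum_monomial_multiIdx hp]
  refine Finset.sum_eq_zero fun α hα => ?_
  rw [abs_nonpos_iff.1 ((abs_coeff_le_coeffNorm k p hα).trans_eq h), map_zero]

/-- The constraint on the moments `w`, dual to the coefficient norm. -/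
def DualBall (d : ℕ) : NormIdx → ((Fin n →₀ ℕ) → ℝ) → Prop
  | .one, w => ∀ α ∈ (multiIdx n d).erase 0, |w α| ≤ 1
  | .infty, w => ∑ α ∈ (multiIdx n d).erase 0, |w α| ≤ 1

theorem isClosed_dualBall (d : ℕ) (k : NormIdx) :
    IsClosed {w : (Fin n →₀ ℕ) → ℝ | DualBall d k w} := by
  cases k with
  | one =>
    have : {w : (Fin n →₀ ℕ) → ℝ | DualBall d .one w} =
        ⋂ α ∈ (multiIdx n d).erase 0, {w | |w α| ≤ 1} := by ext; simp [DualBall]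
    rw [this]
    exact isClosed_biInter fun α _ => isClosed_le (continuous_apply α).abs continuous_const
  | infty =>
    exact isClosed_le (continuous_finsetSum _ fun α _ => (continuous_apply α).abs)
      continuous_const

theorem dualBall_of_dualNormConstraint {d : ℕ} {k : NormIdx} {u v z : (Fin n →₀ ℕ) → ℝ}
    (hu : ∀ α, 0 ≤ u α) (hv : ∀ α, 0 ≤ v α) (h : dualNormConstraint d k u v)
    (hz : ∀ α ∈ (multiIdx n d).erase 0, u α - v α + z α = 0) : DualBall d k z := by
  have hle : ∀ α ∈ (multiIdx n d).erase 0, |z α| ≤ u α + v α := fun α hα => by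
    have := hz α hα
    rw [abs_le]
    constructor <;> linarith [hu α, hv α]
  cases k with
  | one => exact fun α hα => (hle α hα).trans (h α hα)
  | infty => exact (Finset.sum_le_sum hle).trans h

theorem sum_mul_le_coeffNorm {d : ℕ} {k : NormIdx} {w : (Fin n →₀ ℕ) → ℝ} (hw : DualBall d k w)
    (p : MvPolynomial (Fin n) ℝ) :
    ∑ α ∈ (multiIdx n d).erase 0, p.coeff α * w α ≤ coeffNorm d k p := by
  have h1 : ∑ α ∈ (multiIdx n d).erase 0, p.coeff α * w α ≤
      ∑ α ∈ (multiIdx n d).erase 0, |p.coeff α| * |w α| :=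
    Finset.sum_le_sum fun α _ => (le_abs_self _).trans_eq (abs_mul _ _)
  refine h1.trans ?_
  cases k with
  | one =>
    calc _ ≤ ∑ α ∈ (multiIdx n d).erase 0, |p.coeff α| :=
          Finset.sum_le_sum fun α hα => mul_le_of_le_one_right (abs_nonneg _) (hw α hα)
      _ ≤ _ := Finset.sum_le_sum_of_subset_of_nonneg (Finset.erase_subset _ _)
          fun _ _ _ => abs_nonneg _
  | infty =>
    calc _ ≤ ∑ α ∈ (multiIdx n d).erase 0, coeffNorm d .infty p * |w α| :=
          Finset.sum_le_sum fun α hα => mul_le_mul_of_nonneg_right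
            (abs_coeff_le_coeffNorm _ p (Finset.mem_of_mem_erase hα)) (abs_nonneg _)
      _ = coeffNorm d .infty p * ∑ α ∈ (multiIdx n d).erase 0, |w α| := by rw [Finset.mul_sum]
      _ ≤ _ := mul_le_of_le_one_right (coeffNorm_nonneg _ _ _) hw

/-- Subtracting the value at 0 removes the index `α = 0`, the one moment that the dual ball leaves
free; the rest is Hölder. -/
theorem rieszLin_sub_C_le_coeffNorm {d : ℕ} {k : NormIdx} {w : (Fin n →₀ ℕ) → ℝ}
    (hw : DualBall d k w) {p : MvPolynomial (Fin n) ℝ} (hp : p.totalDegree ≤ d) :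
    rieszLin w (p - C (eval 0 p)) ≤ coeffNorm d k p := by
  refine le_of_eq_of_le ?_ (sum_mul_le_coeffNorm hw p)
  have h0 : (0 : Fin n →₀ ℕ) ∈ multiIdx n d := by simp [mem_multiIdx]
  have h1 : eval 0 p = p.coeff 0 := by
    rw [← constantCoeff_eq, ← eval_zero]
  have h2 : p = C (p.coeff 0) + ∑ α ∈ (multiIdx n d).erase 0, monomial α (p.coeff α) := by
    conv_lhs => rw [eq_sum_monomial_multiIdx hp, ← Finset.add_sum_erase _ _ h0]
    rfl
  rw [h1, sub_eq_of_eq_add' h2, map_sum]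
  simp only [rieszLin_monomial]

end CoeffNorm

/-! ### The inverse problems: monotonicity, existence, weak duality and the limit measure. -/

section Inverse

variable {n m : ℕ} {k : NormIdx} {f : MvPolynomial (Fin n) ℝ} {g : Fin m → MvPolynomial (Fin n) ℝ}

theorem truncQuadModule_subset_quadModule (d : ℕ) : truncQuadModule g d ⊆ quadModule g := by
  rintro _ ⟨σ₀, σ, h₀, h, rfl⟩
  exact ⟨σ₀, σ, h₀.1, fun j => (h j).1, rfl⟩

theorem truncQuadModule_mono : Monotone (truncQuadModule g) := by
  rintro d e hde _ ⟨σ₀, σ, h₀, h, rfl⟩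
  exact ⟨σ₀, σ, ⟨h₀.1, h₀.2.trans (by omega)⟩, fun j => ⟨(h j).1, (h j).2.trans (by omega)⟩, rfl⟩

theorem practicalFeasible_mono : Monotone (practicalFeasible f g) :=
  fun _ _ hde _ hh => ⟨hh.1, truncQuadModule_mono hde hh.2⟩

theorem practicalFeasible_subset_idealFeasible (d : ℕ) :
    practicalFeasible f g d ⊆ idealFeasible f g :=
  fun _ hh => ⟨hh.1, fun _ hx =>
    eval_nonneg_of_mem_quadModule (truncQuadModule_subset_quadModule d hh.2) hx⟩

theorem zero_mem_practicalFeasible (d : ℕ) : (0 : MvPolynomial (Fin n) ℝ) ∈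
    practicalFeasible f g d := by
  refine ⟨by simp, 0, 0, ⟨.zero, by simp⟩, fun j => ⟨.zero, by simp⟩, by simp⟩

theorem bddBelow_coeffNorm_image (s : Set (MvPolynomial (Fin n) ℝ)) :
    BddBelow ((fun h => coeffNorm f.totalDegree k (h - f)) '' s) :=
  ⟨0, by rintro _ ⟨h, -, rfl⟩; exact coeffNorm_nonneg _ _ _⟩

theorem practicalValue_antitone : Antitone (practicalValue k f g) := fun d _ hde =>
  csInf_le_csInf (bddBelow_coeffNorm_image _) ⟨_, 0, zero_mem_practicalFeasible d, rfl⟩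
    (Set.image_mono (practicalFeasible_mono hde))

theorem idealValue_le_practicalValue (d : ℕ) : idealValue k f g ≤ practicalValue k f g d :=
  csInf_le_csInf (bddBelow_coeffNorm_image _) ⟨_, 0, zero_mem_practicalFeasible d, rfl⟩
    (Set.image_mono (practicalFeasible_subset_idealFeasible d))

theorem IsIdealOptimal.coeffNorm_eq {h : MvPolynomial (Fin n) ℝ} (hh : IsIdealOptimal k f g h) :
    coeffNorm f.totalDegree k (h - f) = idealValue k f g :=
  le_antisymm (le_csInf ⟨_, h, hh.1, rfl⟩ (by rintro _ ⟨h', hh', rfl⟩; exact hh.2 h' hh'))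
    (csInf_le (bddBelow_coeffNorm_image _) ⟨h, hh.1, rfl⟩)

theorem totalDegree_sub_le_of_mem {h : MvPolynomial (Fin n) ℝ} (hh : h ∈ idealFeasible f g) :
    (h - f).totalDegree ≤ f.totalDegree :=
  (totalDegree_sub _ _).trans (max_le hh.1 le_rfl)

/-- The polynomial with given coefficients of degree at most `d`. -/
noncomputable def polyOfCoeffs (d : ℕ) (c : multiIdx n d → ℝ) : MvPolynomial (Fin n) ℝ :=
  ∑ α, monomial α.1 (c α)

theorem coeff_polyOfCoeffs {d : ℕ} (c : multiIdx n d → ℝ) (α : multiIdx n d) :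
    (polyOfCoeffs d c).coeff α.1 = c α := by
  simp only [polyOfCoeffs, coeff_sum, coeff_monomial, Subtype.coe_inj]
  simp

theorem totalDegree_polyOfCoeffs_le {d : ℕ} (c : multiIdx n d → ℝ) :
    (polyOfCoeffs d c).totalDegree ≤ d := by
  refine totalDegree_finsetSum_le fun α _ => (totalDegree_monomial_le _ _).trans ?_
  exact mem_multiIdx.1 α.2

theorem polyOfCoeffs_coeff {d : ℕ} {p : MvPolynomial (Fin n) ℝ} (hp : p.totalDegree ≤ d) :
    polyOfCoeffs d (fun α => p.coeff α.1) = p := by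
  conv_rhs => rw [eq_sum_monomial_multiIdx hp]
  exact Finset.sum_coe_sort (multiIdx n d) fun α => monomial α (p.coeff α)

theorem continuous_eval_polyOfCoeffs (d : ℕ) (x : Fin n → ℝ) :
    Continuous fun c : multiIdx n d → ℝ => eval x (polyOfCoeffs d c) := by
  simp only [polyOfCoeffs, map_sum, eval_monomial]
  fun_prop

theorem continuous_coeffNorm_polyOfCoeffs_sub (d : ℕ) (k : NormIdx) (f : MvPolynomial (Fin n) ℝ) :
    Continuous fun c : multiIdx n d → ℝ => coeffNorm d k (polyOfCoeffs d c - f) := by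
  have h : ∀ α ∈ multiIdx n d, Continuous fun c : multiIdx n d → ℝ =>
      |(polyOfCoeffs d c - f).coeff α| := fun α hα => by
    simp only [coeff_sub, coeff_polyOfCoeffs _ ⟨α, hα⟩]
    fun_prop
  cases k with
  | one => exact continuous_finsetSum _ h
  | infty => exact Continuous.finset_sup'_apply (multiIdx_nonempty n d) h

theorem exists_isIdealOptimal (k : NormIdx) (f : MvPolynomial (Fin n) ℝ)
    (g : Fin m → MvPolynomial (Fin n) ℝ) : ∃ h, IsIdealOptimal k f g h := by
  set d := f.totalDegree with hd
  let N : (multiIdx n d → ℝ) → ℝ := fun c => coeffNorm d k (polyOfCoeffs d c - f)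
  have hN : Continuous N := continuous_coeffNorm_polyOfCoeffs_sub d k f
  -- The zero polynomial is feasible, so minimization may be restricted to the sublevel set of its
  -- value, which is closed and bounded in coefficient space.
  let T : Set (multiIdx n d → ℝ) := {c | polyOfCoeffs d c ∈ idealFeasible f g ∧ N c ≤ N 0}
  have hT : IsCompact T := by
    refine (isCompact_univ_pi fun α => isCompact_Icc (a := f.coeff α.1 - N 0)
      (b := f.coeff α.1 + N 0)).of_isClosed_subset ?_ fun c hc α _ => ?_
    · have : T = (⋂ x ∈ feasSet g, {c | 0 ≤ eval x (polyOfCoeffs d c) -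
          eval 0 (polyOfCoeffs d c)}) ∩ {c | N c ≤ N 0} := by
        ext c
        simp [T, idealFeasible, totalDegree_polyOfCoeffs_le, ← hd]
      rw [this]
      exact (isClosed_biInter fun x _ => isClosed_le continuous_const
        ((continuous_eval_polyOfCoeffs d x).sub (continuous_eval_polyOfCoeffs d 0))).inter
        (isClosed_le hN continuous_const)
    · have := (abs_coeff_le_coeffNorm k (polyOfCoeffs d c - f) α.2).trans hc.2
      rw [coeff_sub, coeff_polyOfCoeffs, abs_le] at this
      constructor <;> linarith
  have h0 : (0 : multiIdx n d → ℝ) ∈ T := by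
    refine ⟨?_, le_rfl⟩
    have : polyOfCoeffs d (0 : multiIdx n d → ℝ) = 0 := by simp [polyOfCoeffs]
    rw [this]
    exact practicalFeasible_subset_idealFeasible 0 (zero_mem_practicalFeasible 0)
  obtain ⟨c, hc, hmin⟩ := hT.exists_isMinOn ⟨0, h0⟩ hN.continuousOn
  refine ⟨polyOfCoeffs d c, hc.1, fun h' hh' => ?_⟩
  obtain ⟨c', rfl⟩ : ∃ c', polyOfCoeffs d c' = h' := ⟨_, polyOfCoeffs_coeff hh'.1⟩
  rcases le_total (N c') (N 0) with hle | hle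
  · exact hmin ⟨hh', hle⟩
  · exact (hmin h0).trans hle

theorem integrableOn_eval {K : Set (Fin n → ℝ)} (hK : IsCompact K) {μ : Measure (Fin n → ℝ)}
    [IsFiniteMeasure μ] (p : MvPolynomial (Fin n) ℝ) :
    IntegrableOn (fun x => eval x p) K μ :=
  (continuous_eval p).continuousOn.integrableOn_compact hK

theorem setIntegral_eval_eq_rieszLin {K : Set (Fin n → ℝ)} (hK : IsCompact K)
    {μ : Measure (Fin n → ℝ)} [IsFiniteMeasure μ] (p : MvPolynomial (Fin n) ℝ) :
    ∫ x in K, eval x p ∂μ = rieszLin (fun α => ∫ x in K, eval x (monomial α 1) ∂μ) p := by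
  induction p using MvPolynomial.induction_on' with
  | monomial α a =>
    rw [rieszLin_monomial, ← integral_const_mul]
    simp [eval_monomial]
  | add p q hp hq =>
    simp only [map_add]
    rw [integral_add (integrableOn_eval hK p) (integrableOn_eval hK q), hp, hq]

theorem momentConstraint_iff_dualBall {d : ℕ} {K : Set (Fin n → ℝ)} {μ : Measure (Fin n → ℝ)} :
    momentConstraint d K k μ ↔ DualBall d k fun α => ∫ x in K, eval x (monomial α 1) ∂μ := by
  cases k <;> rfl

/-- The two integrands add up to `(h - f) - (h - f)(0)`. The slack integral is kept on the left
because complementary slackness needs it. -/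
theorem setIntegral_add_le_coeffNorm (hK : IsCompact (feasSet g)) {μ : Measure (Fin n → ℝ)}
    (hμ : IsMeasureFeasible k f g μ) {h : MvPolynomial (Fin n) ℝ} (hh : h ∈ idealFeasible f g) :
    ∫ x in feasSet g, (eval 0 f - eval x f) ∂μ +
      ∫ x in feasSet g, eval x (h - C (eval 0 h)) ∂μ ≤ coeffNorm f.totalDegree k (h - f) := by
  have := hμ.1
  refine le_of_eq_of_le ?_ (rieszLin_sub_C_le_coeffNorm (momentConstraint_iff_dualBall.1 hμ.2.2)
    (totalDegree_sub_le_of_mem hh))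
  have e : ∀ x, eval 0 f - eval x f = eval x (C (eval 0 f) - f) := fun x => by simp
  simp only [e]
  rw [← setIntegral_eval_eq_rieszLin hK, ← integral_add (integrableOn_eval hK _)
    (integrableOn_eval hK _)]
  congr 1
  ext x
  simp only [map_sub, eval_C]
  ring

theorem IsMeasureFeasible.setIntegral_le_coeffNorm (hK : IsCompact (feasSet g))
    {μ : Measure (Fin n → ℝ)} (hμ : IsMeasureFeasible k f g μ) {h : MvPolynomial (Fin n) ℝ}
    (hh : h ∈ idealFeasible f g) :
    ∫ x in feasSet g, (eval 0 f - eval x f) ∂μ ≤ coeffNorm f.totalDegree k (h - f) := by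
  have h1 := setIntegral_add_le_coeffNorm hK hμ hh
  have h2 := setIntegral_nonneg (μ := μ) hK.measurableSet hh.2
  linarith

theorem zero_mem_globalMinimizers (h_zero : (0 : Fin n → ℝ) ∈ feasSet g)
    {h : MvPolynomial (Fin n) ℝ} (hh : h ∈ idealFeasible f g) :
    0 ∈ globalMinimizers (feasSet g) h :=
  ⟨h_zero, fun y hy => by simpa using hh.2 y hy⟩

/-- Complementary slackness: a measure attaining the ideal value is supported on the minimizers of
every optimal polynomial. -/
theorem IsIdealOptimal.measure_compl_globalMinimizers (hK : IsCompact (feasSet g))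
    {μ : Measure (Fin n → ℝ)} (hμ : IsMeasureFeasible k f g μ)
    (hval : idealValue k f g ≤ ∫ x in feasSet g, (eval 0 f - eval x f) ∂μ)
    {h : MvPolynomial (Fin n) ℝ} (hh : IsIdealOptimal k f g h) :
    μ (globalMinimizers (feasSet g) h)ᶜ = 0 := by
  have := hμ.1
  have h1 := setIntegral_add_le_coeffNorm hK hμ hh.1
  rw [hh.coeffNorm_eq] at h1
  have hnn : 0 ≤ᵐ[μ.restrict (feasSet g)] fun x => eval x (h - C (eval 0 h)) :=
    (ae_restrict_iff' hK.measurableSet).2 (Eventually.of_forall hh.1.2)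
  -- The value of `μ` already exhausts the bound `ρ`, leaving nothing for the slack; hence `h =
  -- h(0)` almost everywhere.
  have h2 : ∫ x in feasSet g, eval x (h - C (eval 0 h)) ∂μ = 0 :=
    le_antisymm (by linarith) (integral_nonneg_of_ae hnn)
  have h3 := (setIntegral_eq_zero_iff_of_nonneg_ae hnn (integrableOn_eval hK _)).1 h2
  have h4 := (ae_restrict_iff' hK.measurableSet).1 h3
  have h5 : ∀ᵐ x ∂μ, x ∈ feasSet g := by
    rw [ae_iff]
    exact hμ.2.1
  refine ae_iff.1 ?_
  filter_upwards [h4, h5] with x hx hxK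
  refine ⟨hxK, fun y hy => ?_⟩
  have h6 := hx hxK
  have h7 := hh.1.2 y hy
  simp only [map_sub, eval_C, Pi.zero_apply] at h6 h7
  linarith

/-- A limit of asymptotically optimal solutions of the dual problems is given by a feasible measure
for the measure dual, whose value is at least all limits of the values. -/
theorem exists_isMeasureFeasible_ge (h_arch : IsArchimedean g)
    {z : ℕ → (Fin n →₀ ℕ) → ℝ}
    (hz : ∀ᶠ d in atTop, IsDualFeasible k f g d (z d))
    (h_liminf : liminf (fun d => ((z d 0 : ℝ) : EReal)) atTop < ⊤) {r : ℕ → ℝ} {ρ : ℝ}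
    (hr : Tendsto r atTop (𝓝 ρ))
    (hρ : ∀ᶠ d in atTop, r d ≤ rieszFun (z d) (C (eval 0 f) - f)) :
    ∃ μ, IsMeasureFeasible k f g μ ∧ ρ ≤ ∫ x in feasSet g, (eval 0 f - eval x f) ∂μ := by
  obtain ⟨c, hc, -⟩ := EReal.lt_iff_exists_real_btwn.1 h_liminf
  have hfreq := (frequently_lt_of_liminf_lt (by isBoundedDefault) hc).mono
    fun d hd => (EReal.coe_lt_coe_iff.1 hd).le
  -- A real `c` above the liminf bounds `z d 0` for infinitely many `d` only; the ultrafilter is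
  -- chosen to live on these.
  have : (atTop ⊓ 𝓟 {d | z d 0 ≤ c}).NeBot := frequently_mem_iff_neBot.1 hfreq
  set U := Ultrafilter.of (atTop ⊓ 𝓟 {d | z d 0 ≤ c})
  have hU := Ultrafilter.of_le (atTop ⊓ 𝓟 {d | z d 0 ≤ c})
  have hUtop : (U : Filter ℕ) ≤ atTop := hU.trans inf_le_left
  have hUc : ∀ᶠ d in (U : Filter ℕ), z d 0 ≤ c :=
    hU (mem_inf_of_right (mem_principal_self _))
  let Λ : ℕ → MvPolynomial (Fin n) ℝ →ₗ[ℝ] ℝ := fun d => rieszLin (z d)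
  have hz := hz.filter_mono hUtop
  have hL : ∀ q, ∀ᶠ d in (U : Filter ℕ), 0 ≤ Λ d (q ^ 2) := fun q => by
    filter_upwards [hz, hUtop (eventually_ge_atTop q.totalDegree)] with d hd hq
    have := hd.2.1
    rw [momentMatrix_eq_localizingMatrix] at this
    simpa using rieszLin_mul_sq_nonneg this hq
  have hg : ∀ j q, ∀ᶠ d in (U : Filter ℕ), 0 ≤ Λ d (g j * q ^ 2) := fun j q => by
    -- For such `d` the order `d - halfDeg (g j)` is at least `deg q`, so the localizing matrix can
    -- be tested against `q`.
    filter_upwards [hz, hUtop (eventually_ge_atTop (q.totalDegree + halfDeg (g j)))] with d hd hq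
    exact rieszLin_mul_sq_nonneg (hd.2.2 j) (by omega)
  have hΛ : ∀ d α, Λ d (monomial α 1) = z d α := fun d α => by rw [rieszLin_monomial, one_mul]
  have hone : ∀ᶠ d in (U : Filter ℕ), Λ d 1 ≤ c := hUc.mono fun d hd => (hΛ d 0).trans_le hd
  obtain ⟨L, hlim⟩ := exists_tendsto_linearMap
    (exists_eventually_abs_apply_le h_arch hL hg hone)
  have hLsq : ∀ q, 0 ≤ L (q ^ 2) := fun q => ge_of_tendsto (hlim _) (hL q)
  have hLg : ∀ j, g j ∈ posMultipliers L := fun j q => ge_of_tendsto (hlim _) (hg j q)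
  obtain ⟨μ, hμ, hμK, hint⟩ := exists_measure_of_nonneg (isCompact_feasSet h_arch)
    fun p hp => apply_nonneg_of_nonneg_on_feasSet h_arch hLsq hLg hp
  refine ⟨μ, ⟨hμ, hμK, momentConstraint_iff_dualBall.2 ?_⟩, ?_⟩
  · simp only [hint]
    have hz' : Tendsto z U (𝓝 fun α => L (monomial α 1)) := by
      refine tendsto_pi_nhds.2 fun α => ?_
      simpa only [hΛ] using hlim (monomial α 1)
    refine (isClosed_dualBall _ k).mem_of_tendsto hz' (hz.mono fun d hd => ?_)
    obtain ⟨u, v, hu, hv, huv, he⟩ := hd.1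
    exact dualBall_of_dualNormConstraint hu hv huv he
  · have e : ∀ x, eval 0 f - eval x f = eval x (C (eval 0 f) - f) := fun x => by simp
    simp only [e, hint]
    refine le_of_tendsto_of_tendsto (hr.mono_left hUtop) (hlim _) ?_
    filter_upwards [hUtop hρ] with d hd
    rwa [rieszFun_eq_rieszLin] at hd

end Inverse

end InversePoly

/-! ### The lemma itself. -/

open InversePoly
theorem lemma3p7 {n m : ℕ} (k : NormIdx) (f : MvPolynomial (Fin n) ℝ)
    (g : Fin m → MvPolynomial (Fin n) ℝ)
    (h_zero : (0 : Fin n → ℝ) ∈ feasSet g)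
    (h_int : (interior (feasSet g)).Nonempty)
    (h_arch : IsArchimedean g)
    (z : ℕ → (Fin n →₀ ℕ) → ℝ)
    (hz : ∀ d : ℕ, 1 ≤ d → f.totalDegree ≤ 2 * d → (∀ j, halfDeg (g j) ≤ d) →
      IsDualFeasible k f g d (z d) ∧
        practicalValue k f g d - 1 / (d : ℝ) ≤ rieszFun (z d) (C (eval 0 f) - f))
    (h_liminf : liminf (fun d => ((z d 0 : ℝ) : EReal)) atTop < ⊤) :
    Tendsto (practicalValue k f g) atTop (𝓝 (idealValue k f g)) ∧
    (∃ h, IsIdealOptimal k f g h) ∧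
    (∃ μ : Measure (Fin n → ℝ), IsMeasureOptimal k f g μ ∧
      ∀ h, IsIdealOptimal k f g h →
        0 ∈ globalMinimizers (feasSet g) h ∧ μ (globalMinimizers (feasSet g) h)ᶜ = 0) ∧
    (∀ h, IsIdealOptimal k f g h →
      (idealValue k f g = 0 ∧ 0 ∈ globalMinimizers (feasSet g) f) ∨
      (0 < idealValue k f g ∧
        ∃ x ∈ globalMinimizers (feasSet g) h, x ≠ 0 ∧ eval x f < eval 0 f)) := by
  have hK := isCompact_feasSet h_arch
  have hev : ∀ᶠ d in atTop, IsDualFeasible k f g d (z d) ∧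
      practicalValue k f g d - 1 / (d : ℝ) ≤ rieszFun (z d) (C (eval 0 f) - f) := by
    filter_upwards [eventually_ge_atTop 1, eventually_ge_atTop f.totalDegree,
      eventually_all.2 fun j => eventually_ge_atTop (halfDeg (g j))] with d h1 h2 h3
    exact hz d h1 (by omega) h3
  obtain ⟨h₀, hh₀⟩ := exists_isIdealOptimal k f g
  have hlim := tendsto_atTop_ciInf (practicalValue_antitone (k := k) (f := f) (g := g))
    ⟨idealValue k f g, by rintro _ ⟨d, rfl⟩; exact idealValue_le_practicalValue d⟩
  have hρ : idealValue k f g ≤ ⨅ d, practicalValue k f g d :=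
    le_ciInf idealValue_le_practicalValue
  -- The error `1 / d` disappears in the limit, so the value of `μ` is at least `inf ρ_d`.
  obtain ⟨μ, hμ, hval⟩ := exists_isMeasureFeasible_ge h_arch (hev.mono fun _ h => h.1) h_liminf
    (by simpa using hlim.sub tendsto_one_div_atTop_nhds_zero_nat) (hev.mono fun _ h => h.2)
  have hle : ∀ ν, IsMeasureFeasible k f g ν →
      ∫ x in feasSet g, (eval 0 f - eval x f) ∂ν ≤ idealValue k f g := fun ν hν =>
    (hν.setIntegral_le_coeffNorm hK hh₀.1).trans_eq hh₀.coeffNorm_eq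
  have hμρ := hρ.trans hval
  refine ⟨?_, ⟨h₀, hh₀⟩, ⟨μ, ⟨hμ, fun ν hν => (hle ν hν).trans hμρ⟩, fun h hh =>
    ⟨zero_mem_globalMinimizers h_zero hh.1, hh.measure_compl_globalMinimizers hK hμ hμρ⟩⟩,
    fun h hh => ?_⟩
  · rwa [le_antisymm (hval.trans (hle μ hμ)) hρ] at hlim
  · have hnn : 0 ≤ idealValue k f g := hh.coeffNorm_eq ▸ coeffNorm_nonneg _ _ _
    rcases hnn.eq_or_lt with h0 | h0
    · have : h = f := sub_eq_zero.1 (eq_zero_of_coeffNorm_eq_zero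
        (totalDegree_sub_le_of_mem hh.1) (hh.coeffNorm_eq.trans h0.symm))
      exact .inl ⟨h0.symm, this ▸ zero_mem_globalMinimizers h_zero hh.1⟩
    · refine .inr ⟨h0, ?_⟩
      -- Otherwise `f(0) - f ≤ 0` on all minimizers of `h`, which carry `μ`, and the dual value `ρ`
      -- could not be positive.
      by_contra! hcon
      have hae : ∀ᵐ x ∂μ, x ∈ globalMinimizers (feasSet g) h :=
        ae_iff.2 (hh.measure_compl_globalMinimizers hK hμ hμρ)
      have : ∫ x in feasSet g, (eval 0 f - eval x f) ∂μ ≤ 0 := by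
        refine integral_nonpos_of_ae (ae_restrict_of_ae (hae.mono fun x hx => ?_))
        by_cases hx0 : x = 0
        · simp [hx0]
        · simpa using hcon x hx hx0
      linarith
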